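/- Let $G$ be a finite group and let $M$ be a $G$-module, i.e. an abelian group with a $\mathbb{Z}$-linear action of $G$. Suppose that for every subgroup $H \le G$ one has $$H^1(H,M) = 0 \quad\text{and}\quad H^2(H,M) = 0,$$ where $H$ acts on $M$ by restriction of the action of $G$. Then $$H_T^r(G,M) = 0 \quad \text{for all } r \in \mathbb{Z}.$$ Here $H_T^r(G,M)$ denotes Tate cohomology: $H_T^r(G,M) = H^r(G,M)$ for $r \ge 1$, $H_T^0(G,M) = M^G/\mathrm{Nm}_G(M)$, $H_T^{-1}(G,M) = \ker(\mathrm{Nm}_G)/I_G M$, and $H_T^r(G,M) = H_{-(r+1)}(G,M)$ for $r \le -2$, where $\mathrm{Nm}_G : M \to M$ is $m \mapsto \sum_{g \in G} g\cdot m$ and $I_G$ is the augmentation ideal of $\mathbb{Z}[G]$. -/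

import Mathlib

universe u

noncomputable section

instance gModule_smulCommClass (G M : Type u) [Group G] [AddCommGroup M] [DistribMulAction G M] :
    SMulCommClass G (ULift.{u} ℤ) M where
  smul_comm g n m := smul_comm g n.down m

/-- A `G`-module `M` (an abelian group with an additive action of `G`), regarded as an object of
Mathlib's category of `G`-representations over the ring of integers. The coefficient ring is the
copy `ULift.{u} ℤ` of `ℤ` only because Mathlib's group (co)homology wants the coefficient ring and
the group in the same universe; a module over it is the same thing as an abelian group. -/
abbrev gModuleRep (G M : Type u) [Group G] [AddCommGroup M] [DistribMulAction G M] :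
    Rep.{u} (ULift.{u} ℤ) G :=
  Rep.ofDistribMulAction (ULift.{u} ℤ) G M

end

namespace TateCohomology

open CategoryTheory CategoryTheory.Limits

/-! Two reductions combine. A class is killed by the index of each Sylow subgroup on which it
restricts to zero, and these indices have no common prime factor, so vanishing on all `p`-subgroups
suffices (`isZero_zero_of_vanishesOnPGroups`). For a `p`-group `K`, induct on the order: a
nontrivial `K` has a proper normal subgroup `S` with cyclic quotient. Periodicity of the cohomology
of `K ⧸ S` on the `S`-invariants, written out with elements, passes from degrees `-1, 0` to `1`
(`exists_eq_apply_sub`) and from `0, 1` to `-1` (`mem_coinvariants_ker`). Dimension shifting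
(`exists_isZero_res_iff_add`) moves both arguments to arbitrary degrees, so two consecutive
vanishing degrees, here `1` and `2`, spread to all of `ℤ`. -/

lemma isZero_of_retract {C : Type*} [Category* C] [HasZeroMorphisms C] {X Y : C}
    (r : Retract X Y) (hY : IsZero Y) : IsZero X :=
  (IsZero.iff_id_eq_zero _).2 <| by rw [← r.retract, hY.eq_of_tgt r.i 0, zero_comp]

/-! ### Tate cohomology in degrees `-1`, `0`, `1` in terms of elements -/

section LowDegree

variable {k K : Type u} [CommRing k] [Group K] [Fintype K] (B : Rep.{u} k K)

lemma isZero_iff_exact (i j l : ℤ) (hij : i + 1 = j) (hjl : j + 1 = l) :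
    IsZero (tateCohomology B j) ↔ ((tateComplex B).sc' i j l).Exact := by
  rw [← HomologicalComplex.exactAt_iff' _ _ _ _ (by simp [← hij]) (by simp [hjl]),
    HomologicalComplex.exactAt_iff_isZero_homology]
  rfl

open groupCohomology in
/-- Vanishing of Tate cohomology in degree zero: every invariant is a norm. -/
lemma isZero_zero_iff : IsZero (tateCohomology B 0) ↔
    ∀ x : B, (∀ g, B.ρ g x = x) → ∃ y, B.ρ.norm y = x := by
  let e : (tateComplex B).sc' (-1) 0 1 ≅ ShortComplex.mk _ _ (Rep.norm_comp_d_eq_zero B) :=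
    ShortComplex.isoMk (groupHomology.chainsIso₀ B) (cochainsIso₀ B) (cochainsIso₁ B)
      (by
        change _ = B.tateNorm ≫ _
        simp [Rep.tateNorm]
        rfl)
      (comp_d₀₁_eq B)
  rw [isZero_iff_exact B (-1) 0 1 rfl rfl, ShortComplex.exact_iff_of_iso e,
    ShortComplex.moduleCat_exact_iff]
  refine forall_congr' fun x ↦ imp_congr_left ?_
  exact ⟨fun h g ↦ sub_eq_zero.1 (congr_fun h g), fun h ↦ funext fun g ↦ sub_eq_zero.2 (h g)⟩

open groupHomology in
/-- Vanishing of Tate cohomology in degree `-1`: every element of norm zero vanishes in the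
coinvariants. -/
lemma isZero_neg_one_iff : IsZero (tateCohomology B (-1)) ↔
    ∀ y : B, B.ρ.norm y = 0 → y ∈ Representation.Coinvariants.ker B.ρ := by
  let e : (tateComplex B).sc' (-2) (-1) 0 ≅ ShortComplex.mk _ _ (Rep.comp_eq_zero B) :=
    ShortComplex.isoMk (chainsIso₁ B) (chainsIso₀ B) (groupCohomology.cochainsIso₀ B)
      (comp_d₁₀_eq B)
      (by
        change _ = B.tateNorm ≫ _
        simp [Rep.tateNorm]
        rfl)
  rw [isZero_iff_exact B (-2) (-1) 0 rfl rfl, ShortComplex.exact_iff_of_iso e,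
    ShortComplex.moduleCat_exact_iff]
  refine forall_congr' fun x ↦ imp_congr_right fun _ ↦ ?_
  rw [← range_d₁₀_eq_coinvariantsKer]
  rfl

omit [Fintype K] in
open groupCohomology in
lemma isZero_groupCohomology_one_iff : IsZero (groupCohomology B 1) ↔
    ∀ f : K → B, (∀ g h, f (g * h) = B.ρ g (f h) + f g) → ∃ m, ∀ g, f g = B.ρ g m - m := by
  rw [ModuleCat.isZero_iff_subsingleton]
  constructor
  · intro h f hf
    obtain ⟨m, hm⟩ := (H1π_eq_zero_iff (⟨f, (mem_cocycles₁_iff f).2 hf⟩ : cocycles₁ B)).1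
      (Subsingleton.elim _ _)
    exact ⟨m, fun g ↦ (congr_fun hm g).symm⟩
  · intro h
    refine subsingleton_of_forall_eq 0 fun x ↦ ?_
    induction x using H1_induction_on with | @h x =>
    obtain ⟨m, hm⟩ := h x ((mem_cocycles₁_iff _).1 x.2)
    exact (H1π_eq_zero_iff x).2 ⟨m, funext fun g ↦ (hm g).symm⟩

lemma isZero_natCast_iff (n : ℕ) [NeZero n] :
    IsZero (tateCohomology B n) ↔ IsZero (groupCohomology B n) :=
  ((isoGroupCohomology n).app B).isZero_iff

/-- Vanishing of Tate cohomology in degree one: every crossed homomorphism is principal. -/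
lemma isZero_one_iff : IsZero (tateCohomology B 1) ↔
    ∀ f : K → B, (∀ g h, f (g * h) = B.ρ g (f h) + f g) → ∃ m, ∀ g, f g = B.ρ g m - m :=
  (isZero_natCast_iff B 1).trans (isZero_groupCohomology_one_iff B)

end LowDegree

/-! ### Acyclicity when the identity is a norm -/

section Acyclic

variable {k K : Type u} [CommRing k] [Group K] [Fintype K] (B : Rep.{u} k K)
  (φ : B →ₗ[k] B)

/-- A representation is a retract of a representation coinduced from the trivial group if its
identity is the norm of a linear endomorphism. -/
noncomputable def retractCoind (hφ : ∀ x, ∑ g, B.ρ g (φ (B.ρ g⁻¹ x)) = x) :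
    Retract B (Rep.coind (⊥ : Subgroup K).subtype (Rep.res (⊥ : Subgroup K).subtype B)) where
  i := Rep.resCoindToHom _ _ _ (𝟙 _)
  r := Rep.ofHom
    { toLinearMap := ∑ g, B.ρ g⁻¹ ∘ₗ φ ∘ₗ LinearMap.proj g ∘ₗ Submodule.subtype _
      isIntertwining' := fun h ↦ by
        ext f
        simp only [LinearMap.comp_apply, LinearMap.sum_apply, map_sum]
        refine Fintype.sum_equiv (Equiv.mulRight h) _ _ fun g ↦ ?_
        change B.ρ g⁻¹ (φ (f.1 (g * h))) = B.ρ h (B.ρ (g * h)⁻¹ (φ (f.1 (g * h))))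
        rw [mul_inv_rev, map_mul, Module.End.mul_apply, Representation.self_inv_apply] }
  retract := by
    ext x
    refine Eq.trans ?_ (hφ x)
    refine Eq.trans (LinearMap.sum_apply _ _ _) ?_
    exact Fintype.sum_equiv (Equiv.inv K) _ _ fun g ↦ by
      rw [Equiv.inv_apply, inv_inv]
      rfl

/-- Away from degrees `0` and `-1`, `B` is a retract of a coinduced module, which is also induced as
`K` is finite, and Shapiro's lemma reduces to the trivial group. The two middle degrees follow
directly from the formula `hφ`. -/
lemma isZero_of_norm_eq_id (hφ : ∀ x, ∑ g, B.ρ g (φ (B.ρ g⁻¹ x)) = x) (r : ℤ) :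
    IsZero (tateCohomology B r) := by
  classical
  have hr := retractCoind B φ hφ
  obtain ⟨n, rfl | rfl⟩ : ∃ n : ℕ, r = n ∨ r = -(n + 1 : ℤ) := by
    obtain h | h := le_or_gt 0 r
    · exact ⟨r.toNat, by omega⟩
    · exact ⟨(-r - 1).toNat, by omega⟩
  · cases n with
    | zero =>
      refine (isZero_zero_iff B).2 fun x hx ↦ ⟨φ x, ?_⟩
      conv_rhs => rw [← hφ x]
      simp [Representation.norm, hx]
    | succ n =>
      rw [isZero_natCast_iff]
      refine isZero_of_retract (hr.map (groupCohomology.functor k K (n + 1))) ?_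
      exact (isZero_groupCohomology_succ_of_subsingleton _ n).of_iso
        (groupCohomology.coindIso _ _)
  · cases n with
    | zero =>
      refine (isZero_neg_one_iff B).2 fun y hy ↦ ?_
      have h : ∑ g, φ (B.ρ g⁻¹ y) = 0 := by
        rw [← map_sum, Fintype.sum_equiv (Equiv.inv K) (fun g ↦ B.ρ g⁻¹ y) (fun g ↦ B.ρ g y)
          fun g ↦ rfl]
        simpa [Representation.norm] using congr(φ $hy)
      rw [← hφ y, ← sub_zero (∑ g, _), ← h, ← Finset.sum_sub_distrib]
      exact Submodule.sum_mem _ fun g _ ↦ Representation.Coinvariants.sub_mem_ker _ _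
    | succ n =>
      refine IsZero.of_iso ?_ ((isoGroupHomology _ (n + 1) rfl).app B)
      refine isZero_of_retract (hr.map (groupHomology.functor k K (n + 1))) ?_
      exact (isZero_groupHomology_succ_of_subsingleton _ n).of_iso
        ((groupHomology.functor k K (n + 1)).mapIso (Rep.indCoindIso _).symm ≪≫
          groupHomology.indIso _ _ _)

end Acyclic

/-! ### Dimension shifting -/

section DimensionShift

variable {k G : Type u} [CommRing k] [Group G]

/-- The functions from a group to a representation of it, with the conjugation action. -/
noncomputable abbrev funRep (A : Rep.{u} k G) : Rep.{u} k G :=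
  Rep.of (X := G → A)
    { toFun g := (A.ρ g).compLeft G ∘ₗ LinearMap.funLeft k A (g⁻¹ * ·)
      map_one' := by ext; simp [LinearMap.funLeft]
      map_mul' g h := by ext; simp [LinearMap.funLeft, mul_assoc] }

@[simp]
lemma funRep_ρ_apply (A : Rep.{u} k G) (g : G) (F : G → A) (x : G) :
    (funRep A).ρ g F x = A.ρ g (F (g⁻¹ * x)) := rfl

lemma isZero_res_funRep (A : Rep.{u} k G) {K : Type u} [Group K] [Fintype K] (f : K →* G)
    (hf : Function.Injective f) (r : ℤ) : IsZero (tateCohomology (Rep.res f (funRep A)) r) := by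
  classical
  -- Cutting functions off to a right transversal `T` of the image of `K` gives an endomorphism of
  -- norm one: each `x` has exactly one `g` with `(f g)⁻¹ * x ∈ T`.
  obtain ⟨T, hT, -⟩ := f.range.exists_isComplement_right 1
  let φ : (G → A) →ₗ[k] (G → A) := LinearMap.pi fun x ↦ if x ∈ T then LinearMap.proj x else 0
  have hφ (F : G → A) (x : G) : φ F x = if x ∈ T then F x else 0 := by
    simp only [φ, LinearMap.pi_apply]
    split_ifs <;> simp
  refine isZero_of_norm_eq_id _ φ (fun F ↦ funext fun x ↦ ?_) r
  have h (g : K) : (funRep A).ρ (f g) (φ ((funRep A).ρ (f g⁻¹) F)) x =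
      if f g⁻¹ * x ∈ T then F x else 0 := by
    rw [funRep_ρ_apply, hφ, map_inv]
    split_ifs
    · rw [funRep_ρ_apply, Representation.self_inv_apply]
      simp
    · simp
  refine (Finset.sum_apply x _ _).trans ((Finset.sum_congr rfl fun g _ ↦ h g).trans ?_)
  obtain ⟨⟨⟨_, g, rfl⟩, t⟩, ht⟩ := hT.2 x
  have hgt : f g * t = x := ht
  rw [Finset.sum_eq_single g, if_pos (by simp [← hgt])]
  · intro g' _ hne
    refine if_neg fun hmem ↦ hne ?_
    have := @hT.1 (⟨f g', g', rfl⟩, ⟨_, hmem⟩) (⟨f g, g, rfl⟩, t) (by simp [hgt])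
    exact hf congr(($this).1.1)
  · simp

/-- The inclusion of a representation in the functions as the constant functions. -/
noncomputable def constHom (A : Rep.{u} k G) : A ⟶ funRep A :=
  Rep.ofHom ⟨LinearMap.pi fun _ ↦ LinearMap.id, fun _ ↦ rfl⟩

instance (A : Rep.{u} k G) : Mono (constHom A) :=
  (Rep.mono_iff_injective _).2 fun _ _ h ↦ congr_fun h 1

/-- The sum of the values of a function. -/
noncomputable def sumHom [Fintype G] (A : Rep.{u} k G) : funRep A ⟶ A :=
  Rep.ofHom ⟨∑ x, LinearMap.proj x, fun g ↦ by
    ext F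
    simp only [LinearMap.comp_apply, LinearMap.sum_apply, map_sum]
    exact Fintype.sum_equiv (Equiv.mulLeft g⁻¹) _ _ fun x ↦ rfl⟩

instance [Fintype G] (A : Rep.{u} k G) : Epi (sumHom A) := by
  classical
  refine (Rep.epi_iff_surjective _).2 fun a ↦ ⟨Pi.single 1 a, ?_⟩
  refine (LinearMap.sum_apply _ _ _).trans ?_
  simp

lemma isZero_res_iff_of_shortExact {S : ShortComplex (Rep.{u} k G)} (hS : S.ShortExact)
    {K : Type u} [Group K] [Fintype K] (f : K →* G)
    (h : ∀ r, IsZero (tateCohomology (Rep.res f S.X₂) r)) (r : ℤ) :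
    IsZero (tateCohomology (Rep.res f S.X₃) r) ↔
      IsZero (tateCohomology (Rep.res f S.X₁) (r + 1)) :=
  ((map_tateComplexFunctor_shortExact ((Rep.shortExact_res f).2 hS)).δIso r (r + 1) rfl
    (h r) (h (r + 1))).isZero_iff

variable [Finite G]

/-- Dimension shifting, simultaneously for all groups mapping injectively to `G`. -/
lemma exists_isZero_res_iff_add (A : Rep.{u} k G) (n : ℤ) : ∃ A' : Rep.{u} k G,
    ∀ (K : Type u) [Group K] [Fintype K] (f : K →* G), Function.Injective f → ∀ r : ℤ,
      (IsZero (tateCohomology (Rep.res f A') r) ↔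
        IsZero (tateCohomology (Rep.res f A) (r + n))) := by
  have := Fintype.ofFinite G
  induction n with
  | zero => exact ⟨A, fun K _ _ f _ r ↦ by rw [add_zero]⟩
  | succ n ih =>
    obtain ⟨A', h⟩ := ih
    have hS : (ShortComplex.mk _ _ (cokernel.condition (constHom A'))).ShortExact :=
      { exact := ShortComplex.exact_cokernel _ }
    refine ⟨cokernel (constHom A'), fun K _ _ f hf r ↦ ?_⟩
    rw [isZero_res_iff_of_shortExact hS f (isZero_res_funRep A' f hf), h K f hf, add_assoc,
      add_comm 1 (n : ℤ)]
  | pred n ih =>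
    obtain ⟨A', h⟩ := ih
    have hS : (ShortComplex.mk _ _ (kernel.condition (sumHom A'))).ShortExact :=
      { exact := ShortComplex.exact_kernel _ }
    refine ⟨kernel (sumHom A'), fun K _ _ f hf r ↦ ?_⟩
    have := isZero_res_iff_of_shortExact hS f (isZero_res_funRep A' f hf) (r - 1)
    rw [sub_add_cancel, h K f hf] at this
    rw [← this]
    ring_nf

end DimensionShift

/-! ### Normal subgroups with cyclic quotient -/

section NormalSubgroup

variable {k K V : Type*} [CommRing k] [Group K] [AddCommGroup V] [Module k V]
  (ρ : Representation k K V) {S : Subgroup K}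

/-- The restriction of a representation to a subgroup. -/
abbrev resSubgroup (S : Subgroup K) : Representation k S V := ρ.comp S.subtype

lemma apply_eq_of_mk_eq {x : V} (hx : ∀ s ∈ S, ρ s x = x) {g h : K}
    (hgh : (g : K ⧸ S) = h) : ρ g x = ρ h x := by
  have := hx _ (QuotientGroup.eq.1 hgh)
  rw [map_mul, Module.End.mul_apply] at this
  rw [← ρ.self_inv_apply g (ρ h x), this]

lemma norm_eq_sum_quotient [Fintype K] [Fintype S] [Fintype (K ⧸ S)] (y : V) :
    ρ.norm y = ∑ q : K ⧸ S, ρ q.out ((resSubgroup ρ S).norm y) := by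
  simp only [Representation.norm, LinearMap.sum_apply, map_sum]
  rw [← Fintype.sum_prod_type' fun (q : K ⧸ S) (s : S) ↦ ρ q.out ((resSubgroup ρ S) s y)]
  refine (Fintype.sum_bijective (fun p : (K ⧸ S) × S ↦ p.1.out * p.2) ⟨?_, fun g ↦ ?_⟩ _ _
    fun p ↦ ?_).symm
  · rintro ⟨q, s⟩ ⟨q', s'⟩ (h : q.out * s = q'.out * s')
    obtain rfl : q = q' := by
      simpa [QuotientGroup.mk_mul_of_mem] using congr((($h : K) : K ⧸ S))
    simpa using h
  · exact ⟨(g, ⟨_, QuotientGroup.eq.1 (QuotientGroup.out_eq' (g : K ⧸ S))⟩),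
      mul_inv_cancel_left _ _⟩
  · rw [map_mul]
    rfl

lemma apply_norm_comp_subtype [Fintype S] [S.Normal] (g : K) (y : V) :
    ρ g ((resSubgroup ρ S).norm y) = (resSubgroup ρ S).norm (ρ g y) := by
  simp only [Representation.norm, LinearMap.sum_apply, map_sum]
  refine Fintype.sum_equiv (MulAut.conjNormal g).toEquiv _ _ fun s ↦ ?_
  simp [← Module.End.mul_apply, ← map_mul]

lemma apply_norm_of_mem [Fintype S] (y : V) : ∀ s ∈ S,
    ρ s ((resSubgroup ρ S).norm y) = (resSubgroup ρ S).norm y :=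
  fun s hs ↦ (resSubgroup ρ S).self_norm_apply ⟨s, hs⟩ y

variable [S.Normal]

lemma apply_apply_of_mem {x : V} (hx : ∀ s ∈ S, ρ s x = x) (g : K) :
    ∀ s ∈ S, ρ s (ρ g x) = ρ g x := fun s hs ↦ by
  rw [← Module.End.mul_apply, ← map_mul]
  refine apply_eq_of_mk_eq ρ hx ?_
  rw [QuotientGroup.mk_mul, (QuotientGroup.eq_one_iff s).2 hs, one_mul]

/-- If `σ` generates `K` modulo `S`, then on the `S`-invariants each `g - 1` factors through
`σ - 1`. -/
lemma exists_apply_sub_eq {σ : K} (hσ : ∀ q : K ⧸ S, q ∈ Subgroup.zpowers (σ : K ⧸ S)) (g : K) :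
    ∀ w : V, (∀ s ∈ S, ρ s w = w) → ∃ z : V, (∀ s ∈ S, ρ s z = z) ∧ ρ g w - w = ρ σ z - z := by
  -- The elements `g` with the required property form a subgroup; it contains `σ` and `S`, hence is
  -- all of `K`.
  let D : Subgroup K :=
    { carrier := {g | ∀ w : V, (∀ s ∈ S, ρ s w = w) →
        ∃ z : V, (∀ s ∈ S, ρ s z = z) ∧ ρ g w - w = ρ σ z - z}
      one_mem' := fun w _ ↦ ⟨0, by simp⟩
      mul_mem' := fun {a b} ha hb w hw ↦ by
        obtain ⟨z₁, h₁, h₁'⟩ := ha _ (apply_apply_of_mem ρ hw b)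
        obtain ⟨z₂, h₂, h₂'⟩ := hb w hw
        refine ⟨z₁ + z₂, fun s hs ↦ by rw [map_add, h₁ s hs, h₂ s hs], ?_⟩
        rw [map_add, add_sub_add_comm, ← h₁', ← h₂', map_mul, Module.End.mul_apply]
        abel
      inv_mem' := fun {a} ha w hw ↦ by
        obtain ⟨z, h, h'⟩ := ha _ (apply_apply_of_mem ρ hw a⁻¹)
        rw [Representation.self_inv_apply] at h'
        refine ⟨-z, fun s hs ↦ by rw [map_neg, h s hs], ?_⟩
        rw [map_neg, ← neg_sub, h']
        abel }
  have hσD : σ ∈ D := fun w hw ↦ ⟨w, hw, rfl⟩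
  have hSD (s : K) (hs : s ∈ S) : s ∈ D := fun w hw ↦ ⟨0, by simp, by simp [hw s hs]⟩
  obtain ⟨n, hn⟩ := Subgroup.mem_zpowers_iff.1 (hσ g)
  have hg := D.mul_mem (D.zpow_mem hσD n) (hSD _ (QuotientGroup.eq.1 hn))
  rwa [mul_inv_cancel_left] at hg

/-- A crossed homomorphism on `K` is principal if it is so on a normal subgroup `S` with cyclic
quotient such that the `S`-invariants are norms and the elements of norm zero vanish in the
coinvariants of `K`. -/
lemma exists_eq_apply_sub [Fintype K] [Fintype S] [IsCyclic (K ⧸ S)]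
    (h0 : ∀ x, (∀ s ∈ S, ρ s x = x) → ∃ y, (resSubgroup ρ S).norm y = x)
    (h0' : ∀ y, ρ.norm y = 0 → y ∈ Representation.Coinvariants.ker ρ)
    (f : K → V) (hf : ∀ g h, f (g * h) = ρ g (f h) + f g)
    (hfS : ∃ m, ∀ s ∈ S, f s = ρ s m - m) : ∃ m, ∀ g, f g = ρ g m - m := by
  have := Fintype.ofFinite (K ⧸ S)
  obtain ⟨m, hm⟩ := hfS
  -- After subtracting a principal crossed homomorphism, `f` vanishes on `S`; it then factors
  -- through `K ⧸ S` and has `S`-invariant values.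
  suffices h : ∀ f : K → V, (∀ g h, f (g * h) = ρ g (f h) + f g) → (∀ s ∈ S, f s = 0) →
      ∃ m, ∀ g, f g = ρ g m - m by
    obtain ⟨m', hm'⟩ := h (fun g ↦ f g - (ρ g m - m)) (fun g h ↦ by
      simp only [hf, map_mul, Module.End.mul_apply, map_sub]; abel)
      fun s hs ↦ by rw [hm s hs, sub_self]
    refine ⟨m' + m, fun g ↦ ?_⟩
    rw [← sub_add_cancel (f g) (ρ g m - m), hm', map_add]
    abel
  clear! m f
  intro f hf hfS
  obtain ⟨σ, hσ⟩ := IsCyclic.exists_generator (α := K ⧸ S)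
  obtain ⟨σ, rfl⟩ := QuotientGroup.mk_surjective σ
  have hmk {g h : K} (hgh : (g : K ⧸ S) = h) : f g = f h := by
    rw [← mul_inv_cancel_left g h, hf, hfS _ (QuotientGroup.eq.1 hgh), map_zero, zero_add]
  have hinv (g : K) : ∀ s ∈ S, ρ s (f g) = f g := fun s hs ↦ by
    rw [← add_zero (ρ s (f g)), ← hfS s hs, ← hf]
    exact hmk (by rw [QuotientGroup.mk_mul, (QuotientGroup.eq_one_iff s).2 hs, one_mul])
  obtain ⟨y, hy⟩ := h0 (f σ) (hinv σ)
  -- The norm of `y` is the sum of the translates of `f σ` over `K ⧸ S`, which telescopes by the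
  -- crossed homomorphism identity.
  have hNy : ρ.norm y = 0 := by
    rw [norm_eq_sum_quotient ρ (S := S), hy]
    calc ∑ q : K ⧸ S, ρ q.out (f σ) = ∑ q : K ⧸ S, (f (q * σ).out - f q.out) :=
          Finset.sum_congr rfl fun q _ ↦ by
            rw [eq_sub_iff_add_eq, ← hf]
            exact hmk (by simp)
      _ = 0 := by
        rw [Finset.sum_sub_distrib, sub_eq_zero]
        exact Fintype.sum_equiv (Equiv.mulRight (σ : K ⧸ S)) _ _ fun q ↦ rfl
  -- The `S`-norm carries `g m - m` to `g - 1` applied to an `S`-invariant, so it maps the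
  -- augmentation part of `V` into `σ - 1` applied to the `S`-invariants.
  have hz : ∃ z : V, (∀ s ∈ S, ρ s z = z) ∧ (resSubgroup ρ S).norm y = ρ σ z - z := by
    have hker := h0' y hNy
    clear hNy hy
    induction hker using Submodule.span_induction with
    | mem _ h =>
      obtain ⟨⟨g, m⟩, rfl⟩ := h
      obtain ⟨z, hz, h⟩ := exists_apply_sub_eq ρ hσ g _ (apply_norm_of_mem ρ m)
      exact ⟨z, hz, by rw [← h, map_sub, apply_norm_comp_subtype]⟩
    | zero => exact ⟨0, by simp⟩
    | add _ _ _ _ h₁ h₂ =>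
      obtain ⟨z₁, hz₁, h₁⟩ := h₁
      obtain ⟨z₂, hz₂, h₂⟩ := h₂
      refine ⟨z₁ + z₂, fun s hs ↦ by rw [map_add, hz₁ s hs, hz₂ s hs], ?_⟩
      rw [map_add, h₁, h₂, map_add]
      abel
    | smul c _ _ h =>
      obtain ⟨z, hz, h⟩ := h
      exact ⟨c • z, fun s hs ↦ by rw [map_smul, hz s hs], by rw [map_smul, h, map_smul, smul_sub]⟩
  obtain ⟨z, hz, h⟩ := hz
  rw [hy] at h
  refine ⟨z, ?_⟩
  -- Two crossed homomorphisms agree on a subgroup; this one contains `σ` and `S`.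
  let D : Subgroup K :=
    { carrier := {g | f g = ρ g z - z}
      one_mem' := by simp [hfS 1 S.one_mem]
      mul_mem' := fun {a b} (ha : _ = _) (hb : _ = _) ↦ show _ = _ by
        rw [hf, ha, hb, map_mul, Module.End.mul_apply, map_sub]
        abel
      inv_mem' := fun {a} (ha : _ = _) ↦ show _ = _ by
        have h1 := hf a⁻¹ a
        rw [inv_mul_cancel, hfS 1 S.one_mem, ha, map_sub, Representation.inv_self_apply] at h1
        rw [← sub_eq_zero, h1]
        abel }
  intro g
  obtain ⟨n, hn⟩ := Subgroup.mem_zpowers_iff.1 (hσ g)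
  have hSD : (σ ^ n)⁻¹ * g ∈ D := by
    have := QuotientGroup.eq.1 hn
    change _ = _
    rw [hfS _ this, hz _ this, sub_self]
  have hg := D.mul_mem (D.zpow_mem (x := σ) h n) hSD
  rwa [mul_inv_cancel_left] at hg

/-- For a normal subgroup `S` with cyclic quotient, generated by `σ`, an `S`-invariant element whose
translates sum to zero is the value at `σ` of a crossed homomorphism. -/
lemma exists_crossed_hom [Finite K] [Fintype (K ⧸ S)] {σ : K}
    (hσ : ∀ q : K ⧸ S, q ∈ Subgroup.zpowers (σ : K ⧸ S)) {x : V} (hx : ∀ s ∈ S, ρ s x = x)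
    (hN : ∑ q : K ⧸ S, ρ q.out x = 0) :
    ∃ f : K → V, (∀ g h, f (g * h) = ρ g (f h) + f g) ∧ f σ = x ∧ ∀ s ∈ S, f s = 0 := by
  classical
  -- `F n` is the value forced at `σ ^ n`. The condition `hN` says that `F` vanishes at the order of
  -- `σ` modulo `S`, so `F n` depends only on the class of `σ ^ n`.
  let F (n : ℕ) : V := ∑ i ∈ Finset.range n, ρ (σ ^ i) x
  have hFadd (m n : ℕ) : F (m + n) = ρ (σ ^ m) (F n) + F m := by
    simp only [F, Finset.sum_range_add, map_sum, pow_add, map_mul, Module.End.mul_apply]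
    rw [add_comm]
  have hFo : F (orderOf (σ : K ⧸ S)) = 0 := by
    rw [← hN, ← IsCyclic.image_range_orderOf hσ, Finset.sum_image]
    · exact Finset.sum_congr rfl fun i _ ↦ apply_eq_of_mk_eq ρ hx (by simp)
    · intro i hi j hj hij
      exact pow_injOn_Iio_orderOf (by simpa using hi) (by simpa using hj) hij
  have hFmul (n : ℕ) : F (orderOf (σ : K ⧸ S) * n) = 0 := by
    induction n with
    | zero => simp [F]
    | succ n ih => rw [Nat.mul_succ, hFadd, hFo, ih, map_zero, add_zero]
  have hFmod (n : ℕ) : F n = F (n % orderOf (σ : K ⧸ S)) := by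
    conv_lhs => rw [← Nat.mod_add_div n (orderOf (σ : K ⧸ S)), hFadd, hFmul, map_zero, zero_add]
  have hF {m n : ℕ} (h : (σ : K ⧸ S) ^ m = (σ : K ⧸ S) ^ n) : F m = F n := by
    rw [hFmod m, hFmod n, pow_eq_pow_iff_modEq.1 h]
  have hFinv (n : ℕ) : ∀ s ∈ S, ρ s (F n) = F n := fun s hs ↦ by
    simp only [F, map_sum]
    exact Finset.sum_congr rfl fun i _ ↦ apply_apply_of_mem ρ hx _ s hs
  have hpow (g : K) : ∃ n : ℕ, (σ : K ⧸ S) ^ n = g := mem_powers_iff_mem_zpowers.2 (hσ g)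
  choose n hn using hpow
  refine ⟨fun g ↦ F (n g), fun g h ↦ ?_, ?_, fun s hs ↦ ?_⟩
  · change F (n (g * h)) = ρ g (F (n h)) + F (n g)
    rw [hF (n := n g + n h) (by rw [hn, pow_add, hn, hn]; rfl), hFadd]
    congr 1
    exact apply_eq_of_mk_eq ρ (hFinv _) (hn g)
  · exact (hF (n := 1) (by rw [hn, pow_one])).trans (by simp [F])
  · exact (hF (n := 0) (by rw [hn, pow_zero, (QuotientGroup.eq_one_iff s).2 hs])).trans (by simp [F])

/-- The elements of norm zero vanish in the coinvariants of `K` if they do so for a normal subgroup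
`S` with cyclic quotient such that the `S`-invariants are norms, and if the crossed homomorphisms
on `K` are principal. -/
lemma mem_coinvariants_ker [Fintype K] [Fintype S] [IsCyclic (K ⧸ S)]
    (h0 : ∀ x, (∀ s ∈ S, ρ s x = x) → ∃ y, (resSubgroup ρ S).norm y = x)
    (h0' : ∀ y, (resSubgroup ρ S).norm y = 0 →
      y ∈ Representation.Coinvariants.ker (resSubgroup ρ S))
    (h1 : ∀ f : K → V, (∀ g h, f (g * h) = ρ g (f h) + f g) → ∃ m, ∀ g, f g = ρ g m - m)
    (y : V) (hy : ρ.norm y = 0) : y ∈ Representation.Coinvariants.ker ρ := by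
  have := Fintype.ofFinite (K ⧸ S)
  obtain ⟨σ, hσ⟩ := IsCyclic.exists_generator (α := K ⧸ S)
  obtain ⟨σ, rfl⟩ := QuotientGroup.mk_surjective σ
  obtain ⟨f, hf, hfσ, hfS⟩ := exists_crossed_hom ρ hσ (apply_norm_of_mem ρ y)
    (by rw [← norm_eq_sum_quotient, hy])
  obtain ⟨z, hz⟩ := h1 f hf
  -- As `f` vanishes on `S`, `z` is `S`-invariant, hence an `S`-norm of some `w`. Then `y - (σ w -
  -- w)` has `S`-norm zero, and `h0'` applies to it.
  obtain ⟨w, rfl⟩ := h0 z fun s hs ↦ by rw [← sub_eq_zero, ← hz, hfS s hs]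
  have hle : Representation.Coinvariants.ker (resSubgroup ρ S) ≤
      Representation.Coinvariants.ker ρ := Submodule.span_le.2 <| by
    rintro _ ⟨⟨s, m⟩, rfl⟩
    exact Representation.Coinvariants.sub_mem_ker (s : K) m
  have hyw := hle (h0' (y - (ρ σ w - w)) (by
    rw [map_sub, map_sub, ← apply_norm_comp_subtype, ← hz σ, hfσ, sub_self]))
  rw [← sub_add_cancel y (ρ σ w - w)]
  exact Submodule.add_mem _ hyw (Representation.Coinvariants.sub_mem_ker σ w)

end NormalSubgroup

/-! ### Vanishing on `p`-groups -/

variable {k G : Type u} [CommRing k] [Group G]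

/-- The vanishing of the Tate cohomology in degree `r` of the restrictions of a representation to
all finite `p`-groups embedded in `G`. -/
def VanishesOnPGroups (p : ℕ) (A : Rep.{u} k G) (r : ℤ) : Prop :=
  ∀ (K : Type u) [Group K] [Fintype K] (f : K →* G), Function.Injective f → IsPGroup p K →
    IsZero (tateCohomology (Rep.res f A) r)

/-- By Sylow there is a subgroup of index `p`, and a subgroup whose index is the smallest prime
factor of the group order is normal. -/
lemma exists_normal_isCyclic_quotient {p : ℕ} [Fact p.Prime] {K : Type*} [Group K] [Finite K]
    [Nontrivial K] (hK : IsPGroup p K) : ∃ (S : Subgroup K) (_ : S.Normal), IsCyclic (K ⧸ S) ∧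
      Nat.card S < Nat.card K := by
  obtain ⟨n, hn⟩ := IsPGroup.iff_card.1 hK
  have hp : p.Prime := Fact.out
  obtain ⟨n, rfl⟩ : ∃ m, n = m + 1 := Nat.exists_eq_succ_of_ne_zero fun h ↦ by
    rw [h, pow_zero] at hn
    exact Finite.one_lt_card.ne' hn
  obtain ⟨S, hS⟩ := Sylow.exists_subgroup_card_pow_prime p (G := K) (n := n)
    (hn ▸ pow_dvd_pow p n.le_succ)
  have hi : S.index = p := by
    have := S.card_mul_index
    rw [hS, hn, pow_succ] at this
    exact Nat.eq_of_mul_eq_mul_left (pow_pos hp.pos n) this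
  have hS' : S.Normal := S.normal_of_index_eq_minFac_card <| by
    rw [hi, hn, hp.pow_minFac n.succ_ne_zero]
  refine ⟨S, hS', isCyclic_of_prime_card (p := p) hi, ?_⟩
  rw [hS, hn]
  exact Nat.pow_lt_pow_right hp.one_lt n.lt_succ_self

variable {p : ℕ} [Fact p.Prime] {A : Rep.{u} k G}

/-- Induction on the order of `K`. Quantifying over embedded groups rather than subgroups of `G`
lets the induction pass to `S` by composing embeddings. -/
lemma VanishesOnPGroups.one (h : VanishesOnPGroups p A (-1)) (h0 : VanishesOnPGroups p A 0) :
    VanishesOnPGroups p A 1 := by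
  intro K _ _ f hf hK
  induction hn : Nat.card K using Nat.strong_induction_on generalizing K with | _ n ih =>
  subst hn
  obtain hK' | hK' := subsingleton_or_nontrivial K
  · exact (isZero_natCast_iff _ 1).2 (isZero_groupCohomology_succ_of_subsingleton _ 0)
  · obtain ⟨S, hS, hc, hlt⟩ := exists_normal_isCyclic_quotient hK
    have := Fintype.ofFinite S
    have hfS : Function.Injective (f.comp S.subtype) := hf.comp S.subtype_injective
    have hS0 := (isZero_zero_iff _).1 (h0 S (f.comp S.subtype) hfS (hK.to_subgroup S))
    have hS1 := (isZero_one_iff _).1 (ih _ hlt S (f.comp S.subtype) hfS (hK.to_subgroup S) rfl)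
    refine (isZero_one_iff _).2 fun c hc' ↦ exists_eq_apply_sub (Rep.res f A).ρ (S := S)
      (fun x hx ↦ hS0 x fun s ↦ hx s s.2) ((isZero_neg_one_iff _).1 (h K f hf hK)) c hc' ?_
    obtain ⟨m, hm⟩ := hS1 (fun s ↦ c s) fun s t ↦ hc' s t
    exact ⟨m, fun s hs ↦ hm ⟨s, hs⟩⟩

lemma VanishesOnPGroups.neg_one (h0 : VanishesOnPGroups p A 0) (h1 : VanishesOnPGroups p A 1) :
    VanishesOnPGroups p A (-1) := by
  intro K _ _ f hf hK
  induction hn : Nat.card K using Nat.strong_induction_on generalizing K with | _ n ih =>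
  subst hn
  obtain hK' | hK' := subsingleton_or_nontrivial K
  · refine (isZero_neg_one_iff _).2 fun y hy ↦ ?_
    have : y = 0 := by simpa [Representation.norm, Fintype.sum_subsingleton _ (1 : K)] using hy
    exact this ▸ Submodule.zero_mem _
  · obtain ⟨S, hS, hc, hlt⟩ := exists_normal_isCyclic_quotient hK
    have := Fintype.ofFinite S
    have hfS : Function.Injective (f.comp S.subtype) := hf.comp S.subtype_injective
    have hS0 := (isZero_zero_iff _).1 (h0 S (f.comp S.subtype) hfS (hK.to_subgroup S))
    have hS1 := (isZero_neg_one_iff _).1 (ih _ hlt S (f.comp S.subtype) hfS (hK.to_subgroup S) rfl)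
    exact (isZero_neg_one_iff _).2 <| mem_coinvariants_ker (Rep.res f A).ρ (S := S)
      (fun x hx ↦ hS0 x fun s ↦ hx s s.2) hS1 ((isZero_one_iff _).1 (h1 K f hf hK))

lemma exists_vanishesOnPGroups_iff_add [Finite G] (A : Rep.{u} k G) (n : ℤ) : ∃ A' : Rep.{u} k G,
    ∀ p r, VanishesOnPGroups p A' r ↔ VanishesOnPGroups p A (r + n) := by
  obtain ⟨A', h⟩ := exists_isZero_res_iff_add A n
  exact ⟨A', fun p r ↦ forall_congr' fun K ↦ forall_congr' fun _ ↦ forall_congr' fun _ ↦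
    forall_congr' fun f ↦ forall_congr' fun hf ↦ imp_congr_right fun _ ↦ h K f hf r⟩

lemma VanishesOnPGroups.add_two [Finite G] {r : ℤ} (h : VanishesOnPGroups p A r)
    (h' : VanishesOnPGroups p A (r + 1)) : VanishesOnPGroups p A (r + 2) := by
  -- The shift by `r + 1` puts the two known degrees at `-1` and `0`.
  obtain ⟨A', hA⟩ := exists_vanishesOnPGroups_iff_add A (r + 1)
  have := ((hA p (-1)).2 (by rwa [neg_add_cancel_comm_assoc])).one ((hA p 0).2 (by rwa [zero_add]))
  rw [hA] at this
  convert this using 1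
  ring

lemma VanishesOnPGroups.sub_one [Finite G] {r : ℤ} (h : VanishesOnPGroups p A r)
    (h' : VanishesOnPGroups p A (r + 1)) : VanishesOnPGroups p A (r - 1) := by
  -- The shift by `r` puts the two known degrees at `0` and `1`.
  obtain ⟨A', hA⟩ := exists_vanishesOnPGroups_iff_add A r
  have := ((hA p 0).2 (by rwa [zero_add])).neg_one ((hA p 1).2 (by rwa [add_comm]))
  rw [hA] at this
  convert this using 1
  ring

/-- If the Tate cohomology vanishes on the `p`-groups in two consecutive degrees, then it vanishes
on the `p`-groups in all degrees. -/
lemma VanishesOnPGroups.all [Finite G] {r : ℤ} (h : VanishesOnPGroups p A r)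
    (h' : VanishesOnPGroups p A (r + 1)) (s : ℤ) : VanishesOnPGroups p A s := by
  suffices h : VanishesOnPGroups p A (r + (s - r)) ∧ VanishesOnPGroups p A (r + (s - r) + 1) by
    simpa using h.1
  induction s - r with
  | zero => exact ⟨by rwa [add_zero], by rwa [add_zero]⟩
  | succ n ih =>
    rw [← add_assoc]
    refine ⟨ih.2, ?_⟩
    convert ih.1.add_two ih.2 using 1
    ring
  | pred n ih =>
    rw [← add_sub_assoc, sub_add_cancel]
    exact ⟨ih.1.sub_one ih.2, ih.1⟩

/-! ### Reduction to Sylow subgroups -/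

/-- Tate cohomology in degree zero vanishes if it vanishes on the Sylow subgroups. -/
lemma isZero_zero_of_vanishesOnPGroups [Fintype G]
    (h : ∀ p : ℕ, p.Prime → VanishesOnPGroups p A 0) : IsZero (tateCohomology A 0) := by
  classical
  refine (isZero_zero_iff A).2 fun x hx ↦ ?_
  -- The integers `n` for which `n • x` is a norm. If `x` is the `P`-norm of `y`, then the `G`-norm
  -- of `y` is the index of `P` times `x`, by invariance of `x`.
  let I : AddSubgroup ℤ :=
    (LinearMap.range A.ρ.norm).toAddSubgroup.comap ((zmultiplesHom A) x)
  have hI (n : ℤ) : n ∈ I ↔ ∃ y, A.ρ.norm y = n • x := Iff.rfl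
  have hSylow (p : ℕ) (hp : p.Prime) (P : Sylow p G) : ((P : Subgroup G).index : ℤ) ∈ I := by
    obtain ⟨y, hy⟩ := (isZero_zero_iff _).1
      (h p hp P (P : Subgroup G).subtype (Subgroup.subtype_injective _) P.isPGroup') x fun g ↦ hx g
    refine (hI _).2 ⟨y, ?_⟩
    have hy' : (resSubgroup A.ρ (P : Subgroup G)).norm y = x := hy
    rw [norm_eq_sum_quotient A.ρ (S := (P : Subgroup G)), hy']
    simp [hx, Subgroup.index_eq_card, Nat.card_eq_fintype_card]
  obtain ⟨d, hd⟩ := Int.subgroup_cyclic I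
  rw [← AddSubgroup.zmultiples_eq_closure] at hd
  suffices h1 : (1 : ℤ) ∈ I by simpa using (hI 1).1 h1
  by_contra h1
  have hd1 : d.natAbs ≠ 1 := fun hd1 ↦ h1 <| by
    rw [hd, Int.mem_zmultiples_iff]
    exact Int.natAbs_dvd_natAbs.1 (by simp [hd1])
  -- A prime dividing the generator of `I` would divide the index of a Sylow subgroup for that same
  -- prime.
  obtain ⟨p, hp, hpd⟩ := Nat.exists_prime_and_dvd hd1
  have := Fact.mk hp
  obtain ⟨P⟩ : Nonempty (Sylow p G) := inferInstance
  have hPI := hSylow p hp P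
  rw [hd, Int.mem_zmultiples_iff] at hPI
  exact P.not_dvd_index (hpd.trans (by simpa using Int.natAbs_dvd_natAbs.2 hPI))

lemma isZero_of_vanishesOnPGroups [Fintype G] {r : ℤ}
    (h : ∀ p : ℕ, p.Prime → VanishesOnPGroups p A r) : IsZero (tateCohomology A r) := by
  obtain ⟨A', hA⟩ := exists_isZero_res_iff_add A r
  have h0 := (hA G (MonoidHom.id G) Function.injective_id 0).1 <|
    isZero_zero_of_vanishesOnPGroups fun p hp K _ _ f hf hK ↦
      (hA K f hf 0).2 (by rw [zero_add]; exact h p hp K f hf hK)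
  rwa [zero_add] at h0

/-- The vanishing of group cohomology on all subgroups gives that of Tate cohomology on all
`p`-groups embedded in `G`. -/
lemma vanishesOnPGroups_of_groupCohomology (p n : ℕ) [NeZero n]
    (h : ∀ H : Subgroup G, IsZero (groupCohomology (Rep.res H.subtype A) n)) :
    VanishesOnPGroups p A n := by
  intro K _ _ f hf _
  rw [isZero_natCast_iff]
  exact (h f.range).of_iso <| groupCohomology.mapIso (f.ofInjective hf) (.refl k A)
    (fun _ ↦ rfl) n

end TateCohomology

theorem mainTheorem3 (G : Type u) [Group G] [Fintype G]
    (M : Type u) [AddCommGroup M] [DistribMulAction G M]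
    (hM : ∀ H : Subgroup G,
      CategoryTheory.Limits.IsZero (groupCohomology (Rep.res H.subtype (gModuleRep G M)) 1) ∧
      CategoryTheory.Limits.IsZero (groupCohomology (Rep.res H.subtype (gModuleRep G M)) 2)) :
    ∀ r : ℤ, CategoryTheory.Limits.IsZero (tateCohomology (gModuleRep G M) r) := by
  intro r
  refine TateCohomology.isZero_of_vanishesOnPGroups fun p hp ↦ ?_
  have := Fact.mk hp
  exact TateCohomology.VanishesOnPGroups.all (r := 1)
    (TateCohomology.vanishesOnPGroups_of_groupCohomology p 1 fun H ↦ (hM H).1)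
    (TateCohomology.vanishesOnPGroups_of_groupCohomology p 2 fun H ↦ (hM H).2) r
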